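/- Let $H$ and $U$ be Hilbert spaces over $\mathbb{R}$ or $\mathbb{C}$, let $A : D(A)\subset H\to H$ be a densely defined closed linear operator such that $A$ and its adjoint $A^\star$ are dissipative (that is, $\mathrm{Re}\,\langle Av,v\rangle_H\le 0$ for all $v\in D(A)$ and $\mathrm{Re}\,\langle A^\star w,w\rangle_H\le 0$ for all $w\in D(A^\star)$), let $B\in\mathcal{L}(U,H)$, and let $0<d_0\le d_1$ be constants. For a continuous function $d:[0,\infty)\to\mathbb{R}$ and $v_0\in H$, a (mild) solution on $[0,\infty)$ of $$ v'(t)=(A-d(t)BB^\star)v(t),\qquad v(0)=v_0, \tag{1}$$ is a continuous $v:[0,\infty)\to H$ such that, for every $t\ge 0$, $\int_0^t v(s)\,ds\in D(A)$ and $v(t)=v_0+A\int_0^t v(s)\,ds-\int_0^t d(s)BB^\star v(s)\,ds$. Suppose that the origin of the autonomous system $v'=(A-d_0BB^\star)v$ is globally exponentially stable: there are $K_0,\beta_0>0$ such that $\|v(t)\|_H\le K_0e^{-\beta_0 t}\|v(0)\|_H$ for all $t\ge0$ and all its mild solutions, with arbitrary $v(0)\in H$. Then there are constants $K,\beta>0$,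 depending only on $A$, $B$, $d_0$ and $d_1$, such that for every continuous $d:[0,\infty)\to\mathbb{R}$ with $d_0\le d(t)\le d_1$ for all $t\ge 0$ and every initial condition $v_0\in H$ (given at the initial time $\tau=0$), system (1) has a unique solution $v$, and $$\|v(t)\|_H\le K e^{-\beta t}\|v_0\|_H\qquad\text{for all } t\ge 0 .$$ -/

import Mathlib

open Set MeasureTheory

/-- A (possibly unbounded) linear operator `A : D(A) ⊆ H → H` is dissipative if
`Re ⟨A x, x⟩ ≤ 0` for every `x ∈ D(A)`. -/
def OpDissipative {𝕜 H : Type*} [RCLike 𝕜] [NormedAddCommGroup H] [InnerProductSpace 𝕜 H]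
    (A : H →ₗ.[𝕜] H) : Prop :=
  ∀ x : A.domain, RCLike.re (inner 𝕜 (A x) (x : H)) ≤ 0

/-- `v` is a mild solution on `[0, ∞)` of `v' = (A - d(t) B B*) v`, `v(0) = v₀`: it is continuous
and satisfies the equation integrated in time, that is, for every `t ≥ 0`, `∫₀ᵗ v ∈ D(A)` and
`v(t) = v₀ + A ∫₀ᵗ v(s) ds - ∫₀ᵗ d(s) B B* v(s) ds`. Only the values on `[0, ∞)` matter. When the
closed operator `A` generates a strongly continuous semigroup `T`, this is equivalent to
`v(t) = T(t) v₀ - ∫₀ᵗ T(t - s) d(s) B B* v(s) ds`. -/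
structure IsMildSolution {𝕜 H U : Type*} [RCLike 𝕜]
    [NormedAddCommGroup H] [InnerProductSpace 𝕜 H] [CompleteSpace H]
    [NormedSpace ℝ H] [IsScalarTower ℝ 𝕜 H]
    [NormedAddCommGroup U] [InnerProductSpace 𝕜 U] [CompleteSpace U]
    (A : H →ₗ.[𝕜] H) (B : U →L[𝕜] H) (d : ℝ → ℝ) (v₀ : H) (v : ℝ → H) : Prop where
  initial : v 0 = v₀
  continuousOn : ContinuousOn v (Ici 0)
  integrated : ∀ t : ℝ, 0 ≤ t → ∃ h : (∫ s in (0 : ℝ)..t, v s) ∈ A.domain,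
    v t = v₀ + A ⟨∫ s in (0 : ℝ)..t, v s, h⟩
      - ∫ s in (0 : ℝ)..t, d s • B (ContinuousLinearMap.adjoint B (v s))

/-- The origin of the autonomous system `v' = (A - c B B*) v` is globally exponentially stable. -/
def IsGloballyExpStable {𝕜 H U : Type*} [RCLike 𝕜]
    [NormedAddCommGroup H] [InnerProductSpace 𝕜 H] [CompleteSpace H]
    [NormedSpace ℝ H] [IsScalarTower ℝ 𝕜 H]
    [NormedAddCommGroup U] [InnerProductSpace 𝕜 U] [CompleteSpace U]
    (A : H →ₗ.[𝕜] H) (B : U →L[𝕜] H) (c : ℝ) : Prop :=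
  ∃ K β : ℝ, 0 < K ∧ 0 < β ∧ ∀ (v₀ : H) (v : ℝ → H),
    IsMildSolution A B (fun _ => c) v₀ v →
      ∀ t : ℝ, 0 ≤ t → ‖v t‖ ≤ K * Real.exp (-β * t) * ‖v₀‖

/-! The feedback dissipates energy: `‖v(t)‖² ≤ ‖v₀‖² - 2d₀ ∫₀ᵗ ‖B* v‖²`. Let `w` be the autonomous
solution with gain `d₀` and the same initial state. The difference `v - w` is driven by `-(d - d₀) B
B* v` and damped by `-d₀ B B*`, so Young's inequality gives `‖v - w‖² ≤ (d₁ - d₀)² / (2d₀) ∫ ‖B*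
v‖²` (`norm_sq_sub_le_of_feedback`). The integral is bounded by the energy that `v` has lost. At a
time `τ` at which `w` has halved, this forces `‖v(τ)‖² ≤ γ ‖v₀‖²`, where `γ < 1` depends only on
`d₀` and `d₁` (`norm_sq_le_mul_of_half`). The step can be restarted at each `nτ`, because it holds
for every admissible gain.

Two facts about mild solutions support this. Existence: dissipativity of `A` and `A*` makes `m - A`
invertible, the Yosida approximations generate contractions that converge strongly, Duhamel's
formula solves the inhomogeneous equation, and a Picard series closes the loop. Energy inequality
(`IsInhomMildSolution.norm_sq_le`): mild solutions need not be differentiable, so it is proved after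
smoothing by `J = m (m - A)⁻¹`, and then `m → ∞`. Uniqueness follows from it. -/

open Filter Topology

/-! ### Resolvents of a maximal dissipative operator -/

section Resolvent

variable {𝕜 H : Type*} [RCLike 𝕜] [NormedAddCommGroup H] [InnerProductSpace 𝕜 H]

theorem OpDissipative.re_inner_graph {A : H →ₗ.[𝕜] H} (hA : OpDissipative A) {x w : H}
    (h : (x, w) ∈ A.graph) : RCLike.re (inner 𝕜 w x) ≤ 0 := by
  obtain ⟨y, hy, rfl⟩ := (LinearPMap.mem_graph_iff A).1 h
  simp only at hy
  subst hy
  exact hA y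

/-- `J = m (m - A)⁻¹`, described through the graph of `A`. -/
structure IsScaledResolvent (A : H →ₗ.[𝕜] H) (m : ℝ) (J : H →L[𝕜] H) : Prop where
  mem_graph : ∀ y, (J y, (m : 𝕜) • (J y - y)) ∈ A.graph
  norm_le : ∀ y, ‖J y‖ ≤ ‖y‖
  apply_graph : ∀ x w, (x, w) ∈ A.graph → J ((m : 𝕜) • x - w) = (m : 𝕜) • x

/-- The cross term `-2m Re ⟨w, x⟩` has the favourable sign. Both summands are kept: together they
control the graph norm. -/
theorem norm_sq_smul_sub_ge {m : ℝ} (hm : 0 ≤ m) {x w : H}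
    (h : RCLike.re (inner 𝕜 w x) ≤ 0) :
    (m * ‖x‖) ^ 2 + ‖w‖ ^ 2 ≤ ‖(m : 𝕜) • x - w‖ ^ 2 := by
  rw [@norm_sub_sq 𝕜, norm_smul, RCLike.norm_ofReal, abs_of_nonneg hm, inner_smul_left,
    RCLike.conj_ofReal, RCLike.re_ofReal_mul, inner_re_symm]
  nlinarith [mul_nonneg hm (neg_nonneg.2 h)]

theorem exists_isScaledResolvent [CompleteSpace H] {A : H →ₗ.[𝕜] H}
    (hdense : Dense (A.domain : Set H)) (hclosed : A.IsClosed)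
    (hA : OpDissipative A) (hA' : OpDissipative A.adjoint) {m : ℝ} (hm : 0 < m) :
    ∃ J : H →L[𝕜] H, IsScaledResolvent A m J := by
  have : CompleteSpace A.graph := IsClosed.completeSpace_coe (hs := hclosed)
  let φ : A.graph →L[𝕜] H :=
    ((m : 𝕜) • ContinuousLinearMap.fst 𝕜 H H - ContinuousLinearMap.snd 𝕜 H H).comp
      A.graph.subtypeL
  have hφ : ∀ p : A.graph, φ p = (m : 𝕜) • (p : H × H).1 - (p : H × H).2 := fun p => rfl
  have hge : ∀ p : A.graph, (m * ‖(p : H × H).1‖) ^ 2 + ‖(p : H × H).2‖ ^ 2 ≤ ‖φ p‖ ^ 2 :=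
    fun p => by rw [hφ]; exact norm_sq_smul_sub_ge hm.le (hA.re_inner_graph p.2)
  have h1 : ∀ p : A.graph, m * ‖(p : H × H).1‖ ≤ ‖φ p‖ := fun p =>
    (abs_le_of_sq_le_sq' (by nlinarith [hge p, sq_nonneg ‖(p : H × H).2‖]) (norm_nonneg _)).2
  have h2 : ∀ p : A.graph, ‖(p : H × H).2‖ ≤ ‖φ p‖ := fun p =>
    (abs_le_of_sq_le_sq' (by nlinarith [hge p, sq_nonneg (m * ‖(p : H × H).1‖)]) (norm_nonneg _)).2
  have hanti : AntilipschitzWith (Real.toNNReal (m⁻¹ + 1)) φ := by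
    refine ContinuousLinearMap.antilipschitz_of_bound φ fun p => ?_
    rw [Real.coe_toNNReal _ (by positivity)]
    have h1' : ‖(p : H × H).1‖ ≤ m⁻¹ * ‖φ p‖ := by
      rw [← div_eq_inv_mul, le_div_iff₀ hm, mul_comm]; exact h1 p
    change ‖(p : H × H)‖ ≤ _
    rw [Prod.norm_def]
    refine max_le ?_ ?_
    · linarith [norm_nonneg (φ p)]
    · have := mul_nonneg (inv_nonneg.2 hm.le) (norm_nonneg (φ p))
      linarith [h2 p]
  have hcl : IsClosed (LinearMap.range (φ : A.graph →ₗ[𝕜] H) : Set H) := by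
    have := hanti.isClosed_range φ.uniformContinuous
    rwa [LinearMap.coe_range]
  -- A vector `y` orthogonal to the range of `m - A` satisfies `A* y = m y`, and dissipativity of
  -- `A*` then gives `m ‖y‖² ≤ 0`.
  have hbot : (LinearMap.range (φ : A.graph →ₗ[𝕜] H))ᗮ = ⊥ := by
    rw [Submodule.eq_bot_iff]
    intro y hy
    have key : ∀ x : A.domain, inner 𝕜 ((m : 𝕜) • y) (x : H) = inner 𝕜 y (A x) := by
      intro x
      have := Submodule.inner_left_of_mem_orthogonal (K := LinearMap.range (φ : A.graph →ₗ[𝕜] H))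
        (LinearMap.mem_range_self _ (⟨((x : H), A x), A.mem_graph x⟩ : A.graph)) hy
      change inner 𝕜 y (φ _) = 0 at this
      rw [hφ, inner_sub_right, inner_smul_right] at this
      rw [inner_smul_left, RCLike.conj_ofReal]
      exact sub_eq_zero.1 this
    have hdom := LinearPMap.mem_adjoint_domain_of_exists y ⟨_, key⟩
    have heq := LinearPMap.adjoint_apply_eq hdense ⟨y, hdom⟩ key
    have := hA' ⟨y, hdom⟩
    rw [heq, inner_smul_left, RCLike.conj_ofReal, RCLike.re_ofReal_mul,
      inner_self_eq_norm_sq] at this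
    have h0 : ‖y‖ ^ 2 ≤ 0 := by
      by_contra hc
      exact absurd (mul_pos hm (not_le.1 hc)) (not_lt.2 this)
    exact norm_eq_zero.1 (pow_eq_zero_iff two_ne_zero |>.1 (le_antisymm h0 (sq_nonneg _)))
  have hsurj : Function.Surjective (φ : A.graph →ₗ[𝕜] H) := by
    rw [← LinearMap.range_eq_top, ← hcl.submodule_topologicalClosure_eq]
    exact (Submodule.topologicalClosure_eq_top_iff).2 hbot
  let e := LinearEquiv.ofBijective (φ : A.graph →ₗ[𝕜] H) ⟨hanti.injective, hsurj⟩
  have he : ∀ y, φ (e.symm y) = y := fun y => e.apply_symm_apply y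
  have he' : ∀ p, e.symm (φ p) = p := fun p => e.symm_apply_apply p
  let J₀ : H →ₗ[𝕜] H := (m : 𝕜) • (LinearMap.fst 𝕜 H H ∘ₗ A.graph.subtype ∘ₗ e.symm.toLinearMap)
  have hJ₀ : ∀ y, J₀ y = (m : 𝕜) • (e.symm y : H × H).1 := fun y => rfl
  have hb : ∀ y, ‖J₀ y‖ ≤ ‖y‖ := fun y => by
    rw [hJ₀, norm_smul, RCLike.norm_ofReal, abs_of_pos hm]
    simpa [he] using h1 (e.symm y)
  refine ⟨J₀.mkContinuous 1 (by simpa using hb), ?_, hb, ?_⟩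
  · intro y
    have hy := he y
    rw [hφ] at hy
    have hmem := A.graph.smul_mem (m : 𝕜) (e.symm y).2
    convert hmem using 1
    ext
    · rfl
    · change (m : 𝕜) • (J₀ y - y) = (m : 𝕜) • (e.symm y : H × H).2
      rw [hJ₀]; nth_rw 2 [← hy]; simp
  · intro x w hxw
    change J₀ _ = _
    rw [hJ₀, show (m : 𝕜) • x - w = φ ⟨(x, w), hxw⟩ from rfl, he']

namespace IsScaledResolvent

variable {A : H →ₗ.[𝕜] H} {m : ℝ} {J : H →L[𝕜] H}

theorem apply_graph_right (hJ : IsScaledResolvent A m J) {x w : H} (h : (x, w) ∈ A.graph) :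
    J w = (m : 𝕜) • (J x - x) := by
  have := hJ.apply_graph x w h
  rw [map_sub, map_smul, sub_eq_iff_eq_add] at this
  rw [smul_sub, this]; abel

theorem norm_sub_le (hJ : IsScaledResolvent A m J) (hm : 0 < m) {x w : H}
    (h : (x, w) ∈ A.graph) : ‖J x - x‖ ≤ m⁻¹ * ‖w‖ := by
  have h1 := hJ.norm_le w
  rw [hJ.apply_graph_right h, norm_smul, RCLike.norm_ofReal, abs_of_pos hm] at h1
  rwa [← div_eq_inv_mul, le_div_iff₀ hm, mul_comm]

end IsScaledResolvent

theorem tendsto_of_dense_of_norm_le {F : Type*} [NormedAddCommGroup F] [NormedSpace 𝕜 F]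
    {S : ℕ → H →L[𝕜] F} {S' : H →L[𝕜] F} {D : Set H} (hD : Dense D) {C : ℝ}
    (hS : ∀ n x, ‖S n x‖ ≤ C * ‖x‖) (hS' : ∀ x, ‖S' x‖ ≤ C * ‖x‖)
    (h : ∀ x ∈ D, Tendsto (fun n => S n x) atTop (𝓝 (S' x))) (x : H) :
    Tendsto (fun n => S n x) atTop (𝓝 (S' x)) := by
  rw [Metric.tendsto_atTop]
  intro ε hε
  -- `|C| + 1` serves because nothing is assumed on the sign of `C`.
  obtain ⟨y, hy, hxy⟩ := Metric.dense_iff.1 hD x (ε / (3 * (|C| + 1))) (by positivity)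
  have hxy' : (|C| + 1) * ‖x - y‖ < ε / 3 := by
    rw [Metric.mem_ball, dist_comm, dist_eq_norm, lt_div_iff₀ (by positivity)] at hy
    linarith
  have hC : C * ‖x - y‖ < ε / 3 := lt_of_le_of_lt
    (mul_le_mul_of_nonneg_right (by linarith [le_abs_self C]) (norm_nonneg _)) hxy'
  obtain ⟨N, hN⟩ := Metric.tendsto_atTop.1 (h y hxy) (ε / 3) (by positivity)
  refine ⟨N, fun n hn => ?_⟩
  have h1 := hN n hn
  rw [dist_eq_norm] at h1 ⊢
  have : S n x - S' x = S n (x - y) + (S n y - S' y) - S' (x - y) := by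
    simp only [map_sub]; abel
  rw [this]
  calc _ ≤ ‖S n (x - y)‖ + ‖S n y - S' y‖ + ‖S' (x - y)‖ :=
        (norm_sub_le _ _).trans (add_le_add_left (norm_add_le _ _) _)
    _ < ε := by linarith [hS n (x - y), hS' (x - y)]

theorem tendsto_isScaledResolvent {A : H →ₗ.[𝕜] H} (hdense : Dense (A.domain : Set H))
    {J : ℕ → H →L[𝕜] H} (hJ : ∀ n : ℕ, IsScaledResolvent A (n + 1) (J n)) (x : H) :
    Tendsto (fun n => J n x) atTop (𝓝 x) := by
  refine tendsto_of_dense_of_norm_le (S' := ContinuousLinearMap.id 𝕜 H) hdense (C := 1)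
    (fun n x => by simpa using (hJ n).norm_le x) (fun x => by simp) (fun x hx => ?_) x
  rw [tendsto_iff_norm_sub_tendsto_zero]
  refine squeeze_zero (fun _ => norm_nonneg _)
    (fun n => (hJ n).norm_sub_le (by positivity) (A.mem_graph ⟨x, hx⟩)) ?_
  have := (tendsto_one_div_add_atTop_nhds_zero_nat (𝕜 := ℝ)).mul_const ‖A ⟨x, hx⟩‖
  simpa using this

end Resolvent

/-! ### Contraction semigroups with bounded generators -/

section UniformlyContinuousSemigroup

variable {𝕜 H : Type*} [RCLike 𝕜] [NormedAddCommGroup H] [InnerProductSpace 𝕜 H]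
  [CompleteSpace H]

/-- The group generated by a bounded operator. -/
noncomputable def expFlow (L : H →L[𝕜] H) (t : ℝ) : H →L[𝕜] H :=
  NormedSpace.exp ((t : 𝕜) • L)

variable {L M : H →L[𝕜] H}

omit [CompleteSpace H] in
theorem expFlow_zero : expFlow L 0 = 1 := by simp [expFlow, NormedSpace.exp_zero]

theorem expFlow_add (s t : ℝ) : expFlow L (s + t) = expFlow L s * expFlow L t := by
  let : NormedAlgebra ℚ (H →L[𝕜] H) := NormedAlgebra.restrictScalars ℚ 𝕜 _
  rw [expFlow, RCLike.ofReal_add, add_smul, NormedSpace.exp_add_of_commute]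
  · rfl
  · exact ((Commute.refl L).smul_left _).smul_right _

/-- `L - M` need not be dissipative, but for `0 ≤ s ≤ t` the right-hand side involves only
nonnegative times, so it is a product of contractions when `L` and `M` are dissipative. -/
theorem expFlow_mul_expFlow_sub (h : Commute L M) (s t : ℝ) :
    expFlow M t * expFlow (L - M) s = expFlow M (t - s) * expFlow L s := by
  let : NormedAlgebra ℚ (H →L[𝕜] H) := NormedAlgebra.restrictScalars ℚ 𝕜 _
  rw [expFlow, expFlow, expFlow, expFlow, ← NormedSpace.exp_add_of_commute,
    ← NormedSpace.exp_add_of_commute]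
  · congr 1
    rw [RCLike.ofReal_sub, sub_smul, smul_sub]; abel
  · exact (h.symm.smul_left _).smul_right _
  · exact ((h.symm.sub_right (Commute.refl M)).smul_left _).smul_right _

omit [CompleteSpace H] in
theorem commute_expFlow (h : Commute L M) (t : ℝ) : Commute L (expFlow M t) := by
  let : NormedAlgebra ℚ (H →L[𝕜] H) := NormedAlgebra.restrictScalars ℚ 𝕜 _
  exact (h.smul_right _).exp_right

variable [NormedSpace ℝ H] [IsScalarTower ℝ 𝕜 H]

theorem hasDerivAt_expFlow (L : H →L[𝕜] H) (x : H) (t : ℝ) :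
    HasDerivAt (fun t => expFlow L t x) (L (expFlow L t x)) t := by
  have h := hasDerivAt_exp_smul_const' (𝕂 := 𝕜) L (t : 𝕜)
  have h2 := (ContinuousLinearMap.apply 𝕜 H x).hasFDerivAt.comp_hasDerivAt _ h
  have h3 : HasDerivAt (fun t : ℝ => (t : 𝕜)) 1 t := by
    simpa using (RCLike.ofRealCLM (K := 𝕜)).hasDerivAt (x := t)
  exact (HasDerivAt.scomp t h2 h3).congr_deriv (by simp [expFlow])

theorem continuous_expFlow (L : H →L[𝕜] H) (x : H) : Continuous fun t => expFlow L t x :=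
  continuous_iff_continuousAt.2 fun t => (hasDerivAt_expFlow L x t).continuousAt

theorem norm_expFlow_le (hL : ∀ x, RCLike.re (inner 𝕜 (L x) x) ≤ 0) {t : ℝ} (ht : 0 ≤ t)
    (x : H) : ‖expFlow L t x‖ ≤ ‖x‖ := by
  have hd : ∀ s, HasDerivAt (fun s => RCLike.re (inner 𝕜 (expFlow L s x) (expFlow L s x)))
      (2 * RCLike.re (inner 𝕜 (L (expFlow L s x)) (expFlow L s x))) s := fun s => by
    have h := (hasDerivAt_expFlow L x s).inner 𝕜 (hasDerivAt_expFlow L x s)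
    refine ((RCLike.reCLM (K := 𝕜)).hasFDerivAt.comp_hasDerivAt s h).congr_deriv ?_
    rw [RCLike.reCLM_apply, map_add]
    rw [inner_re_symm (expFlow L s x)]; ring
  have hanti := antitone_of_hasDerivAt_nonpos hd fun s => by
    have := hL (expFlow L s x)
    simp only [Pi.zero_apply]
    linarith
  have := hanti ht
  simp only [inner_self_eq_norm_sq, expFlow_zero] at this
  exact (abs_le_of_sq_le_sq' this (norm_nonneg _)).2

/-- The path `s ↦ exp(tM) exp(s(L - M)) x` joins the two vectors, and its speed on `[0, t]` is at
most `‖(L - M) x‖`. -/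
theorem norm_expFlow_sub_expFlow_le (hL : ∀ x, RCLike.re (inner 𝕜 (L x) x) ≤ 0)
    (hM : ∀ x, RCLike.re (inner 𝕜 (M x) x) ≤ 0) (h : Commute L M) {t : ℝ} (ht : 0 ≤ t) (x : H) :
    ‖expFlow L t x - expFlow M t x‖ ≤ t * ‖L x - M x‖ := by
  have hd : ∀ s, HasDerivAt (fun s => expFlow M t (expFlow (L - M) s x))
      (expFlow M t (expFlow (L - M) s ((L - M) x))) s := fun s => by
    refine (((expFlow M t).restrictScalars ℝ).hasFDerivAt.comp_hasDerivAt s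
      (hasDerivAt_expFlow (L - M) x s)).congr_deriv ?_
    have hc := congrArg (fun T : H →L[𝕜] H => T x) (commute_expFlow (Commute.refl (L - M)) s).eq
    simp only [mul_apply_eq_comp] at hc
    rw [← hc]; rfl
  have hb : ∀ s ∈ Ico (0 : ℝ) t,
      ‖expFlow M t (expFlow (L - M) s ((L - M) x))‖ ≤ ‖L x - M x‖ := fun s hs => by
    rw [← mul_apply_eq_comp, expFlow_mul_expFlow_sub h]
    exact (norm_expFlow_le hM (by linarith [hs.2]) _).trans (norm_expFlow_le hL hs.1 _)
  have := norm_image_sub_le_of_norm_deriv_le_segment' (fun s _ => (hd s).hasDerivWithinAt) hb t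
    (right_mem_Icc.2 ht)
  rw [← mul_apply_eq_comp, expFlow_mul_expFlow_sub h, sub_self, expFlow_zero,
    expFlow_zero] at this
  simpa [mul_comm] using this

theorem norm_expFlow_sub_le (hL : ∀ x, RCLike.re (inner 𝕜 (L x) x) ≤ 0) {s t : ℝ} (hs : 0 ≤ s)
    (ht : 0 ≤ t) (x : H) : ‖expFlow L t x - expFlow L s x‖ ≤ ‖L x‖ * |t - s| := by
  wlog hst : s ≤ t generalizing s t
  · rw [norm_sub_rev, abs_sub_comm]; exact this ht hs (not_le.1 hst).le
  have h1 : expFlow L t x - expFlow L s x = expFlow L s (expFlow L (t - s) x - x) := by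
    rw [map_sub, ← mul_apply_eq_comp, ← expFlow_add, add_sub_cancel]
  have h2 := norm_expFlow_sub_expFlow_le (M := 0) hL (by simp) (Commute.zero_right L)
    (sub_nonneg.2 hst) x
  rw [h1, abs_of_nonneg (sub_nonneg.2 hst), mul_comm]
  refine (norm_expFlow_le hL hs _).trans ?_
  simpa [expFlow, NormedSpace.exp_zero] using h2

end UniformlyContinuousSemigroup

/-! ### Yosida approximation and the limiting flow -/

section Yosida

variable {𝕜 H : Type*} [RCLike 𝕜] [NormedAddCommGroup H] [InnerProductSpace 𝕜 H]

/-- The Yosida approximation `A J = m (J - 1)` of `A`, where `J = m (m - A)⁻¹`. -/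
noncomputable def yosida (m : ℝ) (J : H →L[𝕜] H) : H →L[𝕜] H := (m : 𝕜) • (J - 1)

theorem yosida_apply (m : ℝ) (J : H →L[𝕜] H) (x : H) :
    yosida m J x = (m : 𝕜) • (J x - x) := rfl

namespace IsScaledResolvent

variable {A : H →ₗ.[𝕜] H} {m k : ℝ} {J J' : H →L[𝕜] H}

theorem mem_graph_yosida (hJ : IsScaledResolvent A m J) (x : H) :
    (J x, yosida m J x) ∈ A.graph := hJ.mem_graph x

theorem yosida_of_mem_graph (hJ : IsScaledResolvent A m J) {x w : H} (h : (x, w) ∈ A.graph) :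
    yosida m J x = J w := (hJ.apply_graph_right h).symm

/-- With `L = A J` one has `x = J x - m⁻¹ L x`, hence `Re ⟨L x, x⟩ = Re ⟨A J x, J x⟩ - m⁻¹ ‖L x‖²`.
-/
theorem re_inner_yosida_le (hJ : IsScaledResolvent A m J) (hm : 0 < m) (hA : OpDissipative A)
    (x : H) : RCLike.re (inner 𝕜 (yosida m J x) x) ≤ 0 := by
  have h1 := hA.re_inner_graph (hJ.mem_graph_yosida x)
  have hm' : (m : 𝕜) ≠ 0 := by exact_mod_cast hm.ne'
  have h2 : x = J x - ((m⁻¹ : ℝ) : 𝕜) • yosida m J x := by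
    rw [yosida_apply, RCLike.ofReal_inv, inv_smul_smul₀ hm']; abel
  nth_rw 2 [h2]
  rw [inner_sub_right, inner_smul_right, map_sub, RCLike.re_ofReal_mul, inner_self_eq_norm_sq]
  have := mul_nonneg (inv_nonneg.2 hm.le) (sq_nonneg ‖yosida m J x‖)
  linarith

theorem commute (hJ : IsScaledResolvent A m J) (hJ' : IsScaledResolvent A k J') (h : m ≠ k) :
    Commute J J' := by
  have h' : (m : 𝕜) - k ≠ 0 := sub_ne_zero.2 (by exact_mod_cast h)
  refine ContinuousLinearMap.ext fun y => ?_
  change J (J' y) = J' (J y)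
  have e1 := hJ.apply_graph_right (hJ'.mem_graph y)
  have e2 := hJ'.apply_graph_right (hJ.mem_graph y)
  rw [map_smul, map_sub] at e1 e2
  have e3 : ((m : 𝕜) - k) • (J (J' y) - J' (J y)) = 0 := by
    simp only [smul_sub, sub_smul] at e1 e2 ⊢
    linear_combination (norm := module) -e1 - e2
  exact sub_eq_zero.1 ((smul_eq_zero.1 e3).resolve_left h')

end IsScaledResolvent

theorem commute_yosida {A : H →ₗ.[𝕜] H} {J : ℕ → H →L[𝕜] H}
    (hJ : ∀ n : ℕ, IsScaledResolvent A (n + 1) (J n)) (n m : ℕ) :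
    Commute (yosida (n + 1) (J n)) (yosida (m + 1) (J m)) := by
  have h : Commute (J n) (J m) := by
    rcases eq_or_ne n m with rfl | h
    · exact Commute.refl _
    · exact (hJ n).commute (hJ m) (by simpa using h)
  refine Commute.smul_left (Commute.smul_right ?_ _) _
  exact (h.sub_right (Commute.one_right _)).sub_left (Commute.one_left _)

variable [CompleteSpace H] [NormedSpace ℝ H] [IsScalarTower ℝ 𝕜 H]

theorem cauchySeq_expFlow_yosida {A : H →ₗ.[𝕜] H} (hdense : Dense (A.domain : Set H))
    (hA : OpDissipative A) {J : ℕ → H →L[𝕜] H}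
    (hJ : ∀ n : ℕ, IsScaledResolvent A (n + 1) (J n)) {t : ℝ} (ht : 0 ≤ t) (x : H) :
    CauchySeq fun n : ℕ => expFlow (yosida (n + 1) (J n)) t x := by
  have hdis : ∀ (n : ℕ) x, RCLike.re (inner 𝕜 (yosida (n + 1) (J n) x) x) ≤ 0 := fun n =>
    (hJ n).re_inner_yosida_le (by positivity) hA
  rw [Metric.cauchySeq_iff]
  intro ε hε
  obtain ⟨y, hy, hxy⟩ := Metric.dense_iff.1 hdense x (ε / 3) (by positivity)
  rw [Metric.mem_ball, dist_comm, dist_eq_norm] at hy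
  -- On `D(A)` the Yosida approximation of `A y` is `J n (A y)`, which tends to `A y`.
  have hconv : CauchySeq fun n : ℕ => yosida (n + 1) (J n) y :=
    ((tendsto_isScaledResolvent hdense hJ (A ⟨y, hxy⟩)).congr fun n =>
      ((hJ n).yosida_of_mem_graph (A.mem_graph ⟨y, hxy⟩)).symm).cauchySeq
  obtain ⟨N, hN⟩ := Metric.cauchySeq_iff.1 hconv (ε / 3 / (t + 1)) (by positivity)
  refine ⟨N, fun n hn k hk => ?_⟩
  have h1 := hN n hn k hk
  rw [dist_eq_norm, lt_div_iff₀ (by positivity)] at h1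
  rw [dist_eq_norm]
  have h2 := norm_expFlow_sub_expFlow_le (hdis n) (hdis k) (commute_yosida hJ n k) ht y
  have h3 := norm_expFlow_le (hdis n) ht (x - y)
  have h4 := norm_expFlow_le (hdis k) ht (x - y)
  have h5 : t * ‖yosida (n + 1) (J n) y - yosida (k + 1) (J k) y‖ < ε / 3 := by
    nlinarith [norm_nonneg (yosida (n + 1) (J n) y - yosida (k + 1) (J k) y)]
  have h6 : expFlow (yosida (n + 1) (J n)) t x - expFlow (yosida (k + 1) (J k)) t x =
      expFlow (yosida (n + 1) (J n)) t (x - y) +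
        (expFlow (yosida (n + 1) (J n)) t y - expFlow (yosida (k + 1) (J k)) t y) -
        expFlow (yosida (k + 1) (J k)) t (x - y) := by
    simp only [map_sub]; abel
  rw [h6]
  refine (norm_sub_le _ _).trans_lt ?_
  have := norm_add_le (expFlow (yosida (n + 1) (J n)) t (x - y))
    (expFlow (yosida (n + 1) (J n)) t y - expFlow (yosida (k + 1) (J k)) t y)
  linarith

/-- The exponentials of the Yosida approximations converge strongly to a jointly continuous
flow. -/
theorem exists_tendsto_expFlow_yosida {A : H →ₗ.[𝕜] H} (hdense : Dense (A.domain : Set H))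
    (hA : OpDissipative A) {J : ℕ → H →L[𝕜] H}
    (hJ : ∀ n : ℕ, IsScaledResolvent A (n + 1) (J n)) :
    ∃ T : ℝ → H → H, Continuous (fun p : H × ℝ => T p.2 p.1) ∧ ∀ t, 0 ≤ t → ∀ x,
      Tendsto (fun n : ℕ => expFlow (yosida (n + 1) (J n)) t x) atTop (𝓝 (T t x)) := by
  have hdis : ∀ (n : ℕ) x, RCLike.re (inner 𝕜 (yosida (n + 1) (J n) x) x) ≤ 0 := fun n =>
    (hJ n).re_inner_yosida_le (by positivity) hA
  -- Contractivity holds only forward in time. Freezing the flow at negative times makes the limit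
  -- continuous on the whole line.
  have hex : ∀ t x, ∃ y, Tendsto (fun n : ℕ => expFlow (yosida (n + 1) (J n)) (max t 0) x) atTop
      (𝓝 y) := fun t x =>
    cauchySeq_tendsto_of_complete (cauchySeq_expFlow_yosida hdense hA hJ (le_max_right t 0) x)
  choose T hT using hex
  refine ⟨T, ?_, fun t ht x => by simpa [max_eq_left ht] using hT t x⟩
  refine continuous_prod_of_dense_continuous_lipschitzWith _ 1 hdense (fun x hx => ?_) fun t => ?_
  · have : LipschitzWith (Real.toNNReal ‖A ⟨x, hx⟩‖) (fun t => T t x) := by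
      refine LipschitzWith.of_dist_le_mul fun t s => ?_
      rw [Real.coe_toNNReal _ (norm_nonneg _), dist_eq_norm, Real.dist_eq]
      refine le_of_tendsto ((hT t x).sub (hT s x)).norm (Eventually.of_forall fun n => ?_)
      refine (norm_expFlow_sub_le (hdis n) (le_max_right s 0) (le_max_right t 0) x).trans ?_
      refine mul_le_mul ?_ (abs_max_sub_max_le_abs t s 0) (abs_nonneg _) (norm_nonneg _)
      rw [(hJ n).yosida_of_mem_graph (A.mem_graph ⟨x, hx⟩)]
      exact (hJ n).norm_le _
    exact this.continuous
  · refine LipschitzWith.of_dist_le_mul fun x y => ?_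
    rw [NNReal.coe_one, one_mul, dist_eq_norm, dist_eq_norm]
    refine le_of_tendsto ((hT t x).sub (hT t y)).norm (Eventually.of_forall fun n => ?_)
    rw [← map_sub]
    exact norm_expFlow_le (hdis n) (le_max_right t 0) _

end Yosida

/-! ### Inhomogeneous mild solutions -/

section Duhamel

variable {𝕜 H : Type*} [RCLike 𝕜] [NormedAddCommGroup H] [InnerProductSpace 𝕜 H]
  [CompleteSpace H] [NormedSpace ℝ H] [IsScalarTower ℝ 𝕜 H]

theorem HasDerivAt.expFlow_apply (L : H →L[𝕜] H) {g : ℝ → H} {g' : H} {t : ℝ}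
    (hg : HasDerivAt g g' t) :
    HasDerivAt (fun t => expFlow L t (g t)) (L (expFlow L t (g t)) + expFlow L t g') t := by
  have h := hasDerivAt_exp_smul_const' (𝕂 := 𝕜) L (t : 𝕜)
  have h3 : HasDerivAt (fun t : ℝ => (t : 𝕜)) 1 t := by
    simpa using (RCLike.ofRealCLM (K := 𝕜)).hasDerivAt (x := t)
  have h4 : HasDerivAt (fun t : ℝ => expFlow L t) (L * expFlow L t) t :=
    (HasDerivAt.scomp t h h3).congr_deriv (by simp [expFlow])
  have h5 : HasDerivAt (fun t : ℝ => (expFlow L t).restrictScalars ℝ)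
      ((L * expFlow L t).restrictScalars ℝ) t :=
    (ContinuousLinearMap.restrictScalarsL 𝕜 H H ℝ ℝ).hasFDerivAt.comp_hasDerivAt t h4
  exact h5.clm_apply hg

omit [NormedSpace ℝ H] [IsScalarTower ℝ 𝕜 H] in
theorem continuous_expFlow_apply (L : H →L[𝕜] H) {X : Type*} [TopologicalSpace X] {τ : X → ℝ}
    (hτ : Continuous τ) {g : X → H} (hg : Continuous g) :
    Continuous fun p => expFlow L (τ p) (g p) := by
  let : NormedAlgebra ℚ (H →L[𝕜] H) := NormedAlgebra.restrictScalars ℚ 𝕜 _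
  have h : Continuous fun t : ℝ => expFlow L t := by
    refine (NormedSpace.exp_continuous (𝔸 := H →L[𝕜] H)).comp ?_
    exact (RCLike.continuous_ofReal (K := 𝕜)).smul continuous_const
  exact (h.comp hτ).clm_apply hg

/-- As `L` is bounded, the flow factors out of the convolution and `z' = L z + f` holds classically.
The integrated form survives the Yosida limit. -/
theorem duhamel_expFlow_integrated (L : H →L[𝕜] H) (x : H) {f : ℝ → H} (hf : Continuous f)
    (t : ℝ) :
    (expFlow L t x + ∫ s in (0 : ℝ)..t, expFlow L (t - s) (f s)) - x - ∫ s in (0 : ℝ)..t, f s =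
      L (∫ r in (0 : ℝ)..t, (expFlow L r x + ∫ s in (0 : ℝ)..r, expFlow L (r - s) (f s))) := by
  set z : ℝ → H := fun r => expFlow L r (x + ∫ s in (0 : ℝ)..r, expFlow L (-s) (f s)) with hz
  have hz' : ∀ r, expFlow L r x + ∫ s in (0 : ℝ)..r, expFlow L (r - s) (f s) = z r := fun r => by
    rw [hz]; simp only
    rw [map_add, ← (expFlow L r).intervalIntegral_comp_comm
      ((continuous_expFlow_apply L continuous_neg hf).intervalIntegrable 0 r)]
    simp only [sub_eq_add_neg, expFlow_add, mul_apply_eq_comp]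
  have hd : ∀ r, HasDerivAt z (L (z r) + f r) r := fun r => by
    have hc := continuous_expFlow_apply L continuous_neg hf
    have h1 := (intervalIntegral.integral_hasDerivAt_right (hc.intervalIntegrable 0 r)
      hc.stronglyMeasurable.stronglyMeasurableAtFilter hc.continuousAt).const_add x
    refine (h1.expFlow_apply L).congr_deriv ?_
    rw [← mul_apply_eq_comp (expFlow L r) (expFlow L (-r)), ← expFlow_add, add_neg_cancel,
      expFlow_zero]
    rfl
  have hzc : Continuous z := continuous_iff_continuousAt.2 fun r => (hd r).continuousAt
  have hLz : Continuous fun r => L (z r) := L.continuous.comp hzc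
  have hftc := intervalIntegral.integral_eq_sub_of_hasDerivAt (fun r _ => hd r)
    ((hLz.add hf).intervalIntegrable 0 t)
  rw [intervalIntegral.integral_add (hLz.intervalIntegrable 0 t) (hf.intervalIntegrable 0 t),
    L.intervalIntegral_comp_comm (hzc.intervalIntegrable 0 t)] at hftc
  simp only [hz']
  have h0 : z 0 = x := by simp [hz, expFlow_zero]
  rw [h0] at hftc
  exact sub_eq_iff_eq_add.2 hftc.symm

/-- `z` is a mild solution on `[0, ∞)` of `z' = A z + f`, `z(0) = x`. -/
structure IsInhomMildSolution (A : H →ₗ.[𝕜] H) (x : H) (f z : ℝ → H) : Prop where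
  continuous : Continuous z
  mem_graph : ∀ t, 0 ≤ t →
    (∫ s in (0 : ℝ)..t, z s, z t - x - ∫ s in (0 : ℝ)..t, f s) ∈ A.graph

theorem exists_isInhomMildSolution {A : H →ₗ.[𝕜] H} (hdense : Dense (A.domain : Set H))
    (hclosed : A.IsClosed) (hA : OpDissipative A) (hA' : OpDissipative A.adjoint) (x : H)
    {f : ℝ → H} (hf : Continuous f) : ∃ z, IsInhomMildSolution A x f z ∧
      ∀ t, 0 ≤ t → ‖z t‖ ≤ ‖x‖ + ∫ s in (0 : ℝ)..t, ‖f s‖ := by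
  have hex : ∀ n : ℕ, ∃ J, IsScaledResolvent A (n + 1) J := fun n =>
    exists_isScaledResolvent hdense hclosed hA hA' (by positivity)
  choose J hJ using hex
  obtain ⟨T, hTc, hT⟩ := exists_tendsto_expFlow_yosida hdense hA hJ
  have hdis : ∀ (n : ℕ) x, RCLike.re (inner 𝕜 (yosida (n + 1) (J n) x) x) ≤ 0 := fun n =>
    (hJ n).re_inner_yosida_le (by positivity) hA
  set E : ℕ → ℝ → H →L[𝕜] H := fun n : ℕ => expFlow (yosida (n + 1) (J n)) with hE
  set zn : ℕ → ℝ → H := fun n t => E n t x + ∫ s in (0 : ℝ)..t, E n (t - s) (f s) with hzn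
  set z : ℝ → H := fun t => T t x + ∫ s in (0 : ℝ)..t, T (t - s) (f s) with hz
  have hzc : Continuous z := by
    refine (hTc.comp (continuous_const.prodMk continuous_id)).add ?_
    refine intervalIntegral.continuous_parametric_intervalIntegral_of_continuous ?_ continuous_id
    exact hTc.comp (f := fun p : ℝ × ℝ => (f p.2, p.1 - p.2)) (by fun_prop)
  have hznc : ∀ n, Continuous (zn n) := fun n => by
    refine (continuous_expFlow _ x).add ?_
    refine intervalIntegral.continuous_parametric_intervalIntegral_of_continuous ?_ continuous_id
    exact continuous_expFlow_apply _ (by fun_prop) (by fun_prop)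
  have hlim : ∀ t, 0 ≤ t → Tendsto (fun n => zn n t) atTop (𝓝 (z t)) := fun t ht => by
    refine (hT t ht x).add ?_
    refine intervalIntegral.tendsto_integral_filter_of_dominated_convergence (fun s => ‖f s‖)
      (Eventually.of_forall fun n => ?_) (Eventually.of_forall fun n => ?_)
      (hf.norm.intervalIntegrable _ _) ?_
    · exact (continuous_expFlow_apply _ (by fun_prop) hf).aestronglyMeasurable
    · refine Eventually.of_forall fun s hs => ?_
      rw [uIoc_of_le ht] at hs
      exact norm_expFlow_le (hdis n) (sub_nonneg.2 hs.2) _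
    · refine Eventually.of_forall fun s hs => ?_
      rw [uIoc_of_le ht] at hs
      exact hT _ (sub_nonneg.2 hs.2) _
  have hbd : ∀ n r, 0 ≤ r → ‖zn n r‖ ≤ ‖x‖ + ∫ s in (0 : ℝ)..r, ‖f s‖ := fun n r hr => by
    refine (norm_add_le _ _).trans (add_le_add (norm_expFlow_le (hdis n) hr x) ?_)
    exact intervalIntegral.norm_integral_le_of_norm_le hr (Eventually.of_forall fun s hs =>
      norm_expFlow_le (hdis n) (sub_nonneg.2 hs.2) _) (hf.norm.intervalIntegrable _ _)
  refine ⟨z, ⟨hzc, fun t ht => ?_⟩, fun t ht =>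
    le_of_tendsto (hlim t ht).norm (Eventually.of_forall fun n => hbd n t ht)⟩
  have hI : Tendsto (fun n => ∫ r in (0 : ℝ)..t, zn n r) atTop (𝓝 (∫ r in (0 : ℝ)..t, z r)) := by
    refine intervalIntegral.tendsto_integral_filter_of_dominated_convergence
      (fun r => ‖x‖ + ∫ s in (0 : ℝ)..r, ‖f s‖)
      (Eventually.of_forall fun n => (hznc n).aestronglyMeasurable)
      (Eventually.of_forall fun n => Eventually.of_forall fun r hr => ?_)
      ((continuous_const.add (intervalIntegral.continuous_primitive
        (fun a b => hf.norm.intervalIntegrable a b) 0)).intervalIntegrable _ _)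
      (Eventually.of_forall fun r hr => ?_)
    · rw [uIoc_of_le ht] at hr; exact hbd n r hr.1.le
    · rw [uIoc_of_le ht] at hr; exact hlim r hr.1.le
  have hJI : Tendsto (fun n => J n (∫ r in (0 : ℝ)..t, zn n r)) atTop
      (𝓝 (∫ r in (0 : ℝ)..t, z r)) := by
    have h1 : Tendsto (fun n => J n ((∫ r in (0 : ℝ)..t, zn n r) - ∫ r in (0 : ℝ)..t, z r)) atTop
        (𝓝 0) :=
      squeeze_zero_norm (fun n => (hJ n).norm_le _) (tendsto_iff_norm_sub_tendsto_zero.1 hI)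
    have h2 := h1.add (tendsto_isScaledResolvent hdense hJ (∫ r in (0 : ℝ)..t, z r))
    simpa [map_sub] using h2
  -- The approximate equation places `(J n (∫ zn), zn - x - ∫ f)` in the graph of `A`; closedness
  -- passes to the limit.
  refine hclosed.mem_of_tendsto
    (hJI.prodMk_nhds (((hlim t ht).sub_const x).sub_const (∫ s in (0 : ℝ)..t, f s)))
    (Eventually.of_forall fun n => ?_)
  have := (hJ n).mem_graph_yosida (∫ r in (0 : ℝ)..t, zn n r)
  rwa [← duhamel_expFlow_integrated _ x hf t] at this

end Duhamel

/-! ### The energy inequality for mild solutions -/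

section Energy

variable {𝕜 H : Type*} [RCLike 𝕜] [NormedAddCommGroup H] [InnerProductSpace 𝕜 H]
  [CompleteSpace H] [NormedSpace ℝ H] [IsScalarTower ℝ 𝕜 H]

namespace IsInhomMildSolution

variable {A : H →ₗ.[𝕜] H} {x y : H} {f g z w : ℝ → H}

omit [CompleteSpace H] [IsScalarTower ℝ 𝕜 H] in
theorem sub (hz : IsInhomMildSolution A x f z) (hw : IsInhomMildSolution A y g w)
    (hf : Continuous f) (hg : Continuous g) :
    IsInhomMildSolution A (x - y) (fun s => f s - g s) (fun s => z s - w s) := by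
  refine ⟨hz.continuous.sub hw.continuous, fun t ht => ?_⟩
  rw [intervalIntegral.integral_sub (hz.continuous.intervalIntegrable 0 t)
    (hw.continuous.intervalIntegrable 0 t), intervalIntegral.integral_sub
    (hf.intervalIntegrable 0 t) (hg.intervalIntegrable 0 t)]
  convert A.graph.sub_mem (hz.mem_graph t ht) (hw.mem_graph t ht) using 1
  rw [Prod.mk_sub_mk]
  congr 1
  abel

omit [CompleteSpace H] [IsScalarTower ℝ 𝕜 H] in
theorem shift (hz : IsInhomMildSolution A x f z) (hf : Continuous f) {a : ℝ} (ha : 0 ≤ a) :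
    IsInhomMildSolution A (z a) (fun s => f (s + a)) (fun s => z (s + a)) := by
  refine ⟨hz.continuous.comp (continuous_add_const a), fun t ht => ?_⟩
  rw [intervalIntegral.integral_comp_add_right, intervalIntegral.integral_comp_add_right, zero_add,
    ← intervalIntegral.integral_interval_sub_left (hz.continuous.intervalIntegrable 0 (t + a))
      (hz.continuous.intervalIntegrable 0 a),
    ← intervalIntegral.integral_interval_sub_left (hf.intervalIntegrable 0 (t + a))
      (hf.intervalIntegrable 0 a)]
  convert A.graph.sub_mem (hz.mem_graph (t + a) (by positivity)) (hz.mem_graph a ha) using 1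
  rw [Prod.mk_sub_mk]
  congr 1
  abel

-- Applying `J` to the integrated equation replaces `A` by the bounded operator `L = A J`, so `J z`
-- is continuously differentiable with derivative `L z + J f`. The term `Re ⟨A J z, J z⟩` is dropped
-- by dissipativity.
omit [IsScalarTower ℝ 𝕜 H] in
theorem norm_sq_resolvent_le (hz : IsInhomMildSolution A x f z) (hf : Continuous f)
    (hA : OpDissipative A) {m : ℝ} {J : H →L[𝕜] H} (hJ : IsScaledResolvent A m J) {t : ℝ}
    (ht : 0 ≤ t) :
    ‖J (z t)‖ ^ 2 ≤ ‖J x‖ ^ 2 + ∫ s in (0 : ℝ)..t, 2 * RCLike.re (inner 𝕜 (J (f s)) (J (z s))) := by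
  set L := yosida m J
  have hzc := hz.continuous
  have hgc : Continuous fun s => L (z s) + J (f s) := by fun_prop
  -- `y` is differentiable on the whole line and equals `J z` for nonnegative times, which avoids
  -- one-sided derivatives at `0`.
  set y : ℝ → H := fun r => J x + ∫ s in (0 : ℝ)..r, (L (z s) + J (f s)) with hy
  have hd : ∀ r, HasDerivAt y (L (z r) + J (f r)) r := fun r =>
    (intervalIntegral.integral_hasDerivAt_right (hgc.intervalIntegrable 0 r)
      hgc.stronglyMeasurable.stronglyMeasurableAtFilter hgc.continuousAt).const_add (J x)
  have hyc : Continuous y := continuous_iff_continuousAt.2 fun r => (hd r).continuousAt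
  have hyz : ∀ r, 0 ≤ r → y r = J (z r) := fun r hr => by
    have h1 := hJ.apply_graph_right (hz.mem_graph r hr)
    change _ = L _ at h1
    have hLz : Continuous fun s => L (z s) := by fun_prop
    have hJf : Continuous fun s => J (f s) := by fun_prop
    rw [hy]
    simp only
    rw [intervalIntegral.integral_add (hLz.intervalIntegrable 0 r) (hJf.intervalIntegrable 0 r),
      L.intervalIntegral_comp_comm (hzc.intervalIntegrable 0 r),
      J.intervalIntegral_comp_comm (hf.intervalIntegrable 0 r), ← h1, map_sub, map_sub]
    abel
  have hd2 : ∀ r, HasDerivAt (fun r => RCLike.re (inner 𝕜 (y r) (y r)))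
      (2 * RCLike.re (inner 𝕜 (L (z r) + J (f r)) (y r))) r := fun r => by
    refine ((RCLike.reCLM (K := 𝕜)).hasFDerivAt.comp_hasDerivAt r
      ((hd r).inner 𝕜 (hd r))).congr_deriv ?_
    rw [RCLike.reCLM_apply, map_add, inner_re_symm (y r)]
    ring
  have hc1 : Continuous fun r => 2 * RCLike.re (inner 𝕜 (L (z r) + J (f r)) (y r)) := by fun_prop
  have hc2 : Continuous fun r => 2 * RCLike.re (inner 𝕜 (J (f r)) (J (z r))) := by fun_prop
  have hftc := intervalIntegral.integral_eq_sub_of_hasDerivAt (fun r _ => hd2 r)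
    (hc1.intervalIntegrable 0 t)
  have hy0 : y 0 = J x := by simp [hy]
  rw [hy0, hyz t ht, inner_self_eq_norm_sq, inner_self_eq_norm_sq] at hftc
  have hmono := intervalIntegral.integral_mono_on (μ := volume) ht (hc1.intervalIntegrable 0 t)
    (hc2.intervalIntegrable 0 t) fun r hr => by
      rw [hyz r hr.1, inner_add_left, map_add]
      linarith [hA.re_inner_graph (hJ.mem_graph_yosida (z r))]
  linarith

omit [IsScalarTower ℝ 𝕜 H] in
theorem norm_sq_le (hz : IsInhomMildSolution A x f z) (hf : Continuous f)
    (hdense : Dense (A.domain : Set H)) (hclosed : A.IsClosed) (hA : OpDissipative A)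
    (hA' : OpDissipative A.adjoint) {t : ℝ} (ht : 0 ≤ t) :
    ‖z t‖ ^ 2 ≤ ‖x‖ ^ 2 + ∫ s in (0 : ℝ)..t, 2 * RCLike.re (inner 𝕜 (f s) (z s)) := by
  have hex : ∀ n : ℕ, ∃ J, IsScaledResolvent A (n + 1) J := fun n =>
    exists_isScaledResolvent hdense hclosed hA hA' (by positivity)
  choose J hJ using hex
  have hlim := tendsto_isScaledResolvent hdense hJ
  have hzc := hz.continuous
  refine le_of_tendsto_of_tendsto' ((hlim (z t)).norm.pow 2)
    (((hlim x).norm.pow 2).add ?_) fun n => hz.norm_sq_resolvent_le hf hA (hJ n) ht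
  refine intervalIntegral.tendsto_integral_filter_of_dominated_convergence
    (fun s => 2 * (‖f s‖ * ‖z s‖))
    (Eventually.of_forall fun n => Continuous.aestronglyMeasurable (by fun_prop))
    (Eventually.of_forall fun n => Eventually.of_forall fun s _ => ?_)
    (Continuous.intervalIntegrable (by fun_prop) _ _) (Eventually.of_forall fun s _ => ?_)
  · rw [norm_mul, Real.norm_two]
    refine mul_le_mul_of_nonneg_left ?_ zero_le_two
    refine (RCLike.abs_re_le_norm _).trans ((norm_inner_le_norm _ _).trans ?_)
    exact mul_le_mul ((hJ n).norm_le _) ((hJ n).norm_le _) (norm_nonneg _) (norm_nonneg _)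
  · exact ((RCLike.continuous_re.tendsto _).comp ((hlim (f s)).inner (hlim (z s)))).const_mul 2

end IsInhomMildSolution

end Energy

/-! ### Existence for the closed loop -/

section Feedback

variable {𝕜 H : Type*} [RCLike 𝕜] [NormedAddCommGroup H] [InnerProductSpace 𝕜 H]
  [CompleteSpace H] [NormedSpace ℝ H] [IsScalarTower ℝ 𝕜 H]

/-- Picard series for `z' = A z - q(t) P z`. -/
theorem exists_isInhomMildSolution_feedback {A : H →ₗ.[𝕜] H} (hdense : Dense (A.domain : Set H))
    (hclosed : A.IsClosed) (hA : OpDissipative A) (hA' : OpDissipative A.adjoint) (P : H →L[𝕜] H)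
    {q : ℝ → ℝ} (hq : Continuous q) {C : ℝ} (hC : ∀ t, |q t| ≤ C) (x : H) :
    ∃ z, IsInhomMildSolution A x (fun s => -(q s • P (z s))) z := by
  obtain ⟨V₀, hV₀, hV₀b⟩ := exists_isInhomMildSolution hdense hclosed hA hA' x
    (f := fun _ => 0) continuous_const
  -- Bundling continuity lets the choice function `Φ` be iterated.
  have hex : ∀ g : C(ℝ, H), ∃ z : C(ℝ, H),
      IsInhomMildSolution A 0 (fun s => -(q s • P (g s))) z ∧
      ∀ t, 0 ≤ t → ‖z t‖ ≤ ‖(0 : H)‖ + ∫ s in (0 : ℝ)..t, ‖-(q s • P (g s))‖ := fun g => by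
    obtain ⟨z, hz, hzb⟩ := exists_isInhomMildSolution hdense hclosed hA hA' 0
      (f := fun s => -(q s • P (g s))) (by fun_prop)
    exact ⟨⟨z, hz.continuous⟩, hz, hzb⟩
  choose Φ hΦ hΦb using hex
  set V : ℕ → C(ℝ, H) := fun k => Φ^[k] ⟨V₀, hV₀.continuous⟩ with hVdef
  have hV0 : ∀ t, V 0 t = V₀ t := fun t => rfl
  have hVs : ∀ k, V (k + 1) = Φ (V k) := fun k => Function.iterate_succ_apply' _ _ _
  set M : ℝ := C * ‖P‖ with hM
  have hC0 : 0 ≤ C := (abs_nonneg _).trans (hC 0)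
  have hM0 : 0 ≤ M := mul_nonneg hC0 (norm_nonneg _)
  have hqP : ∀ s (u : H), ‖q s • P u‖ ≤ M * ‖u‖ := fun s u => by
    rw [norm_smul, Real.norm_eq_abs, hM, mul_assoc]
    exact mul_le_mul (hC s) (P.le_opNorm u) (norm_nonneg _) hC0
  have hVb : ∀ k t, 0 ≤ t → ‖V k t‖ ≤ M ^ k * ‖x‖ * (t ^ k / k.factorial) := by
    intro k
    induction k with
    | zero => intro t ht; simpa [hV0] using hV₀b t ht
    | succ k ih =>
      intro t ht
      have h1 := hΦb (V k) t ht
      rw [← hVs, norm_zero, zero_add] at h1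
      refine h1.trans ?_
      have h2 : ∫ s in (0 : ℝ)..t, ‖-(q s • P (V k s))‖ ≤
          ∫ s in (0 : ℝ)..t, M ^ (k + 1) * ‖x‖ / k.factorial * s ^ k := by
        refine intervalIntegral.integral_mono_on ht
          (Continuous.intervalIntegrable (by fun_prop) _ _)
          (Continuous.intervalIntegrable (by fun_prop) _ _) fun s hs => ?_
        rw [norm_neg]
        refine (hqP s _).trans ((mul_le_mul_of_nonneg_left (ih s hs.1) hM0).trans_eq ?_)
        ring
      refine h2.trans_eq ?_
      rw [intervalIntegral.integral_const_mul, integral_pow, Nat.factorial_succ]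
      push_cast
      field_simp
      simp
  have hVu : ∀ R k t, 0 ≤ t → t ≤ R → ‖V k t‖ ≤ (M * R) ^ k / k.factorial * ‖x‖ := by
    intro R k t ht htR
    refine (hVb k t ht).trans ?_
    calc M ^ k * ‖x‖ * (t ^ k / k.factorial) = (M * t) ^ k / k.factorial * ‖x‖ := by ring
      _ ≤ _ := by gcongr
  have hsum : ∀ R, Summable fun k : ℕ => (M * R) ^ k / k.factorial * ‖x‖ := fun R =>
    (Real.summable_pow_div_factorial (M * R)).mul_right _
  set z : ℝ → H := fun t => ∑' k, V k (max t 0) with hz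
  have hzsum : ∀ t, 0 ≤ t → HasSum (fun k => V k t) (z t) := fun t ht => by
    have : z t = ∑' k, V k t := by simp [hz, max_eq_left ht]
    rw [this]
    exact (Summable.of_norm_bounded (hsum t) fun k => hVu t k t ht le_rfl).hasSum
  have hzc : Continuous z := continuous_iff_continuousAt.2 fun t => by
    refine ContinuousOn.continuousAt (s := Iio (|t| + 1)) ?_
      (Iio_mem_nhds (by linarith [le_abs_self t]))
    refine continuousOn_tsum (fun k => Continuous.continuousOn (by fun_prop)) (hsum (|t| + 1))
      fun k s hs => hVu _ k _ (le_max_right _ _) (max_le (mem_Iio.1 hs).le (by positivity))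
  refine ⟨z, hzc, fun t ht => ?_⟩
  have hI1 : HasSum (fun k => ∫ s in (0 : ℝ)..t, V k s) (∫ s in (0 : ℝ)..t, z s) := by
    refine intervalIntegral.hasSum_integral_of_dominated_convergence
      (fun k _ => (M * t) ^ k / k.factorial * ‖x‖)
      (fun k => (V k).continuous.aestronglyMeasurable)
      (fun k => Eventually.of_forall fun s hs => ?_) (Eventually.of_forall fun s _ => hsum t)
      intervalIntegrable_const (Eventually.of_forall fun s hs => ?_)
    · rw [uIoc_of_le ht] at hs; exact hVu t k s hs.1.le hs.2
    · rw [uIoc_of_le ht] at hs; exact hzsum s hs.1.le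
  have hI2 : HasSum (fun k => ∫ s in (0 : ℝ)..t, -(q s • P (V k s)))
      (∫ s in (0 : ℝ)..t, -(q s • P (z s))) := by
    refine intervalIntegral.hasSum_integral_of_dominated_convergence
      (fun k _ => M * ((M * t) ^ k / k.factorial * ‖x‖))
      (fun k => Continuous.aestronglyMeasurable (by fun_prop))
      (fun k => Eventually.of_forall fun s hs => ?_)
      (Eventually.of_forall fun s _ => (hsum t).mul_left M)
      intervalIntegrable_const (Eventually.of_forall fun s hs => ?_)
    · rw [uIoc_of_le ht] at hs
      rw [norm_neg]
      exact (hqP s _).trans (mul_le_mul_of_nonneg_left (hVu t k s hs.1.le hs.2) hM0)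
    · rw [uIoc_of_le ht] at hs
      exact ((P.hasSum (hzsum s hs.1.le)).const_smul (q s)).neg
  -- The source lags by one index: `V (k + 1)` is driven by `V k`, while `V 0` carries the initial
  -- state.
  have hpart : ∀ N : ℕ, (∑ k ∈ Finset.range (N + 1), ∫ s in (0 : ℝ)..t, V k s,
      ∑ k ∈ Finset.range (N + 1), V k t - x -
        ∑ k ∈ Finset.range N, ∫ s in (0 : ℝ)..t, -(q s • P (V k s))) ∈ A.graph := by
    intro N
    induction N with
    | zero => simpa [hV0] using hV₀.mem_graph t ht
    | succ N ih =>
      have h1 := (hΦ (V N)).mem_graph t ht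
      rw [← hVs] at h1
      convert A.graph.add_mem ih h1 using 1
      rw [Prod.mk_add_mk, Finset.sum_range_succ _ (N + 1), Finset.sum_range_succ _ (N + 1),
        Finset.sum_range_succ _ N]
      congr 1
      rw [Finset.sum_range_succ (fun k => ∫ s in (0 : ℝ)..t, -(q s • P (V k s)))]
      abel
  have hs1 := hI1.tendsto_sum_nat.comp (tendsto_add_atTop_nat 1)
  have hs2 := (hzsum t ht).tendsto_sum_nat.comp (tendsto_add_atTop_nat 1)
  exact hclosed.mem_of_tendsto (hs1.prodMk_nhds ((hs2.sub_const x).sub hI2.tendsto_sum_nat))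
    (Eventually.of_forall hpart)

end Feedback

/-! ### Comparison of closed loops and decay -/

section Stability

variable {𝕜 H U : Type*} [RCLike 𝕜] [NormedAddCommGroup H] [InnerProductSpace 𝕜 H]
  [CompleteSpace H] [NormedSpace ℝ H] [IsScalarTower ℝ 𝕜 H]
  [NormedAddCommGroup U] [InnerProductSpace 𝕜 U] [CompleteSpace U]

theorem IsMildSolution.isInhomMildSolution {A : H →ₗ.[𝕜] H} {B : U →L[𝕜] H} {d : ℝ → ℝ} {x : H}
    {v : ℝ → H} (hv : IsMildSolution A B d x v) :
    IsInhomMildSolution A x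
      (fun s => -(d (max s 0) • (B ∘L B.adjoint) (v (max s 0)))) (fun s => v (max s 0)) := by
  refine ⟨hv.continuousOn.comp_continuous (by fun_prop) fun s => le_max_right s 0,
    fun t ht => ?_⟩
  obtain ⟨h, heq⟩ := hv.integrated t ht
  have e1 : ∫ s in (0 : ℝ)..t, v (max s 0) = ∫ s in (0 : ℝ)..t, v s :=
    intervalIntegral.integral_congr fun s hs => by
      rw [uIcc_of_le ht] at hs; simp only [max_eq_left hs.1]
  have e2 : ∫ s in (0 : ℝ)..t, -(d (max s 0) • (B ∘L B.adjoint) (v (max s 0))) =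
      -∫ s in (0 : ℝ)..t, d s • B (B.adjoint (v s)) := by
    rw [← intervalIntegral.integral_neg]
    exact intervalIntegral.integral_congr fun s hs => by
      rw [uIcc_of_le ht] at hs; simp only [max_eq_left hs.1]; rfl
  rw [e1, e2, max_eq_left ht, heq]
  convert A.mem_graph ⟨_, h⟩ using 2
  abel

theorem IsInhomMildSolution.isMildSolution {A : H →ₗ.[𝕜] H} {B : U →L[𝕜] H} {d q : ℝ → ℝ} {x : H}
    {z : ℝ → H} (hz : IsInhomMildSolution A x (fun s => -(q s • (B ∘L B.adjoint) (z s))) z)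
    (hq : ∀ t, 0 ≤ t → q t = d t) : IsMildSolution A B d x z := by
  have key : ∀ t : ℝ, 0 ≤ t → ∃ h : (∫ s in (0 : ℝ)..t, z s) ∈ A.domain,
      z t = x + A ⟨∫ s in (0 : ℝ)..t, z s, h⟩ -
        ∫ s in (0 : ℝ)..t, d s • B (B.adjoint (z s)) := by
    intro t ht
    obtain ⟨y, hy1, hy2⟩ := (LinearPMap.mem_graph_iff A).1 (hz.mem_graph t ht)
    have hmem : ∫ s in (0 : ℝ)..t, z s ∈ A.domain := by
      have := y.2
      rwa [hy1] at this
    have hy : y = ⟨∫ s in (0 : ℝ)..t, z s, hmem⟩ := Subtype.ext hy1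
    refine ⟨hmem, ?_⟩
    rw [← hy, hy2]
    have : ∫ s in (0 : ℝ)..t, d s • B (B.adjoint (z s)) =
        -∫ s in (0 : ℝ)..t, -(q s • (B ∘L B.adjoint) (z s)) := by
      rw [← intervalIntegral.integral_neg]
      refine intervalIntegral.integral_congr fun s hs => ?_
      rw [uIcc_of_le ht] at hs
      simp only [neg_neg, hq s hs.1]
      rfl
    rw [this]
    simp only
    abel
  refine ⟨?_, hz.continuous.continuousOn, key⟩
  obtain ⟨h, heq⟩ := key 0 le_rfl
  have h0 : (⟨∫ s in (0 : ℝ)..0, z s, h⟩ : A.domain) = 0 := Subtype.ext (by simp)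
  rw [h0, LinearPMap.map_zero] at heq
  simpa using heq

omit [NormedSpace ℝ H] [IsScalarTower ℝ 𝕜 H] in
theorem re_inner_comp_adjoint (B : U →L[𝕜] H) (u w : H) :
    RCLike.re (inner 𝕜 ((B ∘L B.adjoint) u) w) =
      RCLike.re (inner 𝕜 (B.adjoint u) (B.adjoint w)) := by
  rw [ContinuousLinearMap.comp_apply, ContinuousLinearMap.adjoint_inner_right]

omit [CompleteSpace H] in
theorem re_inner_neg_real_smul (r : ℝ) (u w : H) :
    RCLike.re (inner 𝕜 (-(r • u)) w) = -(r * RCLike.re (inner 𝕜 u w)) := by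
  rw [RCLike.real_smul_eq_coe_smul (K := 𝕜), inner_neg_left, inner_smul_left, RCLike.conj_ofReal,
    map_neg, RCLike.re_ofReal_mul]

variable {A : H →ₗ.[𝕜] H} {B : U →L[𝕜] H} {q : ℝ → ℝ} {x : H} {z w : ℝ → H}

theorem norm_sq_le_of_feedback (hdense : Dense (A.domain : Set H)) (hclosed : A.IsClosed)
    (hA : OpDissipative A) (hA' : OpDissipative A.adjoint) (hq : Continuous q)
    (hz : IsInhomMildSolution A x (fun s => -(q s • (B ∘L B.adjoint) (z s))) z) {c : ℝ}
    (hc : ∀ t, 0 ≤ t → c ≤ q t) {t : ℝ} (ht : 0 ≤ t) :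
    ‖z t‖ ^ 2 ≤ ‖x‖ ^ 2 - 2 * c * ∫ s in (0 : ℝ)..t, ‖B.adjoint (z s)‖ ^ 2 := by
  have hzc := hz.continuous
  have h := hz.norm_sq_le (by fun_prop) hdense hclosed hA hA' ht
  refine h.trans ?_
  rw [sub_eq_add_neg, ← neg_mul, ← intervalIntegral.integral_const_mul]
  refine add_le_add_right (intervalIntegral.integral_mono_on ht
    (Continuous.intervalIntegrable (by fun_prop) _ _)
    (Continuous.intervalIntegrable (by fun_prop) _ _) fun s hs => ?_) _
  rw [re_inner_neg_real_smul, re_inner_comp_adjoint, inner_self_eq_norm_sq]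
  nlinarith [mul_le_mul_of_nonneg_right (hc s hs.1) (sq_nonneg ‖B.adjoint (z s)‖)]

/-- The difference solves the same linear equation from the zero state, and its energy cannot grow.
-/
theorem feedback_unique (hdense : Dense (A.domain : Set H)) (hclosed : A.IsClosed)
    (hA : OpDissipative A) (hA' : OpDissipative A.adjoint) (hq : Continuous q)
    (hz : IsInhomMildSolution A x (fun s => -(q s • (B ∘L B.adjoint) (z s))) z)
    (hw : IsInhomMildSolution A x (fun s => -(q s • (B ∘L B.adjoint) (w s))) w)
    (hq0 : ∀ t, 0 ≤ t → 0 ≤ q t) {t : ℝ} (ht : 0 ≤ t) : z t = w t := by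
  have hzc := hz.continuous
  have hwc := hw.continuous
  have he := hz.sub hw (by fun_prop) (by fun_prop)
  have hfe : (fun s => -(q s • (B ∘L B.adjoint) (z s)) - -(q s • (B ∘L B.adjoint) (w s))) =
      fun s => -(q s • (B ∘L B.adjoint) (z s - w s)) := by
    funext s
    rw [map_sub, smul_sub]; abel
  rw [hfe, sub_self] at he
  have h := norm_sq_le_of_feedback hdense hclosed hA hA' hq he hq0 ht
  simp only [norm_zero, mul_zero, zero_mul, sub_zero, ne_eq, OfNat.ofNat_ne_zero,
    not_false_eq_true, zero_pow] at h
  exact sub_eq_zero.1 (norm_eq_zero.1 (pow_eq_zero_iff two_ne_zero |>.1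
    (le_antisymm h (sq_nonneg _))))

/-- Comparison of the closed loops with gains `q` and `c`. -/
theorem norm_sq_sub_le_of_feedback (hdense : Dense (A.domain : Set H)) (hclosed : A.IsClosed)
    (hA : OpDissipative A) (hA' : OpDissipative A.adjoint) (hq : Continuous q)
    (hz : IsInhomMildSolution A x (fun s => -(q s • (B ∘L B.adjoint) (z s))) z) {c C : ℝ}
    (hw : IsInhomMildSolution A x (fun s => -(c • (B ∘L B.adjoint) (w s))) w) (hc : 0 < c)
    (hqC : ∀ t, 0 ≤ t → c ≤ q t ∧ q t ≤ C) {t : ℝ} (ht : 0 ≤ t) :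
    ‖z t - w t‖ ^ 2 ≤
      (C - c) ^ 2 / (2 * c) * ∫ s in (0 : ℝ)..t, ‖B.adjoint (z s)‖ ^ 2 := by
  have hzc := hz.continuous
  have hwc := hw.continuous
  have he := (hz.sub hw (by fun_prop) (by fun_prop)).norm_sq_le (by fun_prop) hdense hclosed hA hA'
    ht
  simp only [sub_self, norm_zero, ne_eq, OfNat.ofNat_ne_zero, not_false_eq_true, zero_pow,
    zero_add] at he
  refine he.trans ?_
  rw [← intervalIntegral.integral_const_mul]
  refine intervalIntegral.integral_mono_on ht
    (Continuous.intervalIntegrable (by fun_prop) _ _)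
    (Continuous.intervalIntegrable (by fun_prop) _ _) fun s hs => ?_
  -- The first part damps the difference by `-2 c a²`; the second is a perturbation bounded by `2 (C
  -- - c) a b`, which Young's inequality absorbs.
  have hsplit : -(q s • (B ∘L B.adjoint) (z s)) - -(c • (B ∘L B.adjoint) (w s)) =
      -(c • (B ∘L B.adjoint) (z s - w s)) + -((q s - c) • (B ∘L B.adjoint) (z s)) := by
    rw [map_sub, smul_sub, sub_smul]; abel
  rw [hsplit, inner_add_left, map_add, re_inner_neg_real_smul, re_inner_neg_real_smul,
    re_inner_comp_adjoint, re_inner_comp_adjoint, inner_self_eq_norm_sq]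
  set a := ‖B.adjoint (z s - w s)‖
  set b := ‖B.adjoint (z s)‖
  set p := RCLike.re (inner 𝕜 (B.adjoint (z s)) (B.adjoint (z s - w s)))
  have hp : |p| ≤ b * a := (RCLike.abs_re_le_norm _).trans (norm_inner_le_norm _ _)
  have h1 : 0 ≤ q s - c := by linarith [(hqC s hs.1).1]
  have h2 : q s - c ≤ C - c := by linarith [(hqC s hs.1).2]
  have h3 : -((q s - c) * p) ≤ (C - c) * (b * a) := by
    calc -((q s - c) * p) = (q s - c) * -p := by ring
      _ ≤ (q s - c) * |p| := mul_le_mul_of_nonneg_left (neg_le_abs p) h1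
      _ ≤ (C - c) * (b * a) := mul_le_mul h2 hp (abs_nonneg _) (h1.trans h2)
  have h4 : 2 * ((C - c) * (b * a)) ≤ 2 * (c * a ^ 2) + (C - c) ^ 2 / (2 * c) * b ^ 2 := by
    have h5 : 2 * (c * a ^ 2) + (C - c) ^ 2 / (2 * c) * b ^ 2 - 2 * ((C - c) * (b * a)) =
        (2 * c * a - (C - c) * b) ^ 2 / (2 * c) := by
      field_simp
      ring
    have : 0 ≤ (2 * c * a - (C - c) * b) ^ 2 / (2 * c) := by positivity
    linarith
  linarith

/-- One step of the decay estimate, after a time `τ` which halves the norm along the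
autonomous closed loop. -/
theorem norm_sq_le_mul_of_half (hdense : Dense (A.domain : Set H)) (hclosed : A.IsClosed)
    (hA : OpDissipative A) (hA' : OpDissipative A.adjoint) (hq : Continuous q)
    (hz : IsInhomMildSolution A x (fun s => -(q s • (B ∘L B.adjoint) (z s))) z) {c C : ℝ}
    (hw : IsInhomMildSolution A x (fun s => -(c • (B ∘L B.adjoint) (w s))) w) (hc : 0 < c)
    (hqC : ∀ t, 0 ≤ t → c ≤ q t ∧ q t ≤ C) {τ : ℝ} (hτ : 0 ≤ τ) (hhalf : ‖w τ‖ ≤ 1 / 2 * ‖x‖) :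
    ‖z τ‖ ^ 2 ≤ (1 / 2 + (C - c) ^ 2 / (2 * c ^ 2)) / (1 + (C - c) ^ 2 / (2 * c ^ 2)) *
      ‖x‖ ^ 2 := by
  have h1 := norm_sq_sub_le_of_feedback hdense hclosed hA hA' hq hz hw hc hqC hτ
  have h2 := norm_sq_le_of_feedback hdense hclosed hA hA' hq hz (fun t ht => (hqC t ht).1) hτ
  set I := ∫ s in (0 : ℝ)..τ, ‖B.adjoint (z s)‖ ^ 2
  have h3 : ‖z τ‖ ≤ 1 / 2 * ‖x‖ + ‖z τ - w τ‖ := by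
    have := norm_add_le (w τ) (z τ - w τ)
    rw [add_sub_cancel] at this
    linarith
  have h4 : ‖z τ‖ ^ 2 ≤ 1 / 2 * ‖x‖ ^ 2 + 2 * ‖z τ - w τ‖ ^ 2 := by
    have := pow_le_pow_left₀ (norm_nonneg _) h3 2
    nlinarith [sq_nonneg (1 / 2 * ‖x‖ - ‖z τ - w τ‖)]
  -- The energy lost by `z` pays for its deviation from `w`. The resulting `-‖z τ‖²` moves to the
  -- left and produces the denominator of the contraction factor.
  have h5 : 2 * ((C - c) ^ 2 / (2 * c) * I) ≤
      (C - c) ^ 2 / (2 * c ^ 2) * (‖x‖ ^ 2 - ‖z τ‖ ^ 2) := by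
    have e : 2 * ((C - c) ^ 2 / (2 * c) * I) = (C - c) ^ 2 / (2 * c ^ 2) * (2 * c * I) := by
      field_simp
    rw [e]
    exact mul_le_mul_of_nonneg_left (by linarith) (by positivity)
  have hQ : 0 ≤ (C - c) ^ 2 / (2 * c ^ 2) := by positivity
  rw [div_mul_eq_mul_div, le_div_iff₀ (by positivity)]
  linarith

/-- Geometric decay at the multiples of `τ` gives exponential decay. -/
theorem le_exp_of_geometric {φ : ℝ → ℝ} {γ τ N : ℝ} (hγ : 0 < γ) (hγ1 : γ < 1) (hτ : 0 < τ)
    (hN : 0 ≤ N) (hφ : ∀ (n : ℕ) t, n * τ ≤ t → φ t ^ 2 ≤ γ ^ n * N ^ 2) {t : ℝ} (ht : 0 ≤ t) :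
    φ t ≤ γ⁻¹ * Real.exp (-(-Real.log γ / (2 * τ)) * t) * N := by
  have hfl : (⌊t / τ⌋₊ : ℝ) * τ ≤ t := by
    rw [← le_div_iff₀ hτ]; exact Nat.floor_le (by positivity)
  have h1 := hφ _ t hfl
  have hlog := Real.log_neg hγ hγ1
  -- The floor exceeds `t / τ - 1`, at the cost of one factor `γ⁻¹`.
  have h2 : γ ^ ⌊t / τ⌋₊ ≤ γ⁻¹ * Real.exp (Real.log γ * (t / τ)) := by
    have e : γ ^ ⌊t / τ⌋₊ = Real.exp (Real.log γ * ⌊t / τ⌋₊) := by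
      rw [mul_comm, Real.exp_nat_mul, Real.exp_log hγ]
    have e' : γ⁻¹ = Real.exp (-Real.log γ) := by rw [Real.exp_neg, Real.exp_log hγ]
    rw [e, e', ← Real.exp_add]
    apply Real.exp_le_exp.2
    nlinarith [(Nat.lt_floor_add_one (t / τ)).le]
  have h3 : Real.exp (Real.log γ * (t / τ)) = Real.exp (-(-Real.log γ / (2 * τ)) * t) ^ 2 := by
    rw [← Real.exp_nat_mul]
    congr 1
    push_cast
    field_simp
  refine (abs_le_of_sq_le_sq' (h1.trans ?_) (by positivity)).2
  rw [mul_pow, mul_pow, ← h3]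
  refine mul_le_mul_of_nonneg_right (h2.trans ?_) (sq_nonneg _)
  refine mul_le_mul_of_nonneg_right ?_ (Real.exp_pos _).le
  -- The square root would give `γ^(-1/2)`; the cruder `γ⁻¹` suffices because `γ < 1`.
  rw [sq]
  exact le_mul_of_one_le_left (by positivity) ((one_le_inv₀ hγ).2 hγ1.le)

end Stability

/-! ### Uniform exponential stability -/

theorem theorem3 {𝕜 H U : Type*} [RCLike 𝕜]
    [NormedAddCommGroup H] [InnerProductSpace 𝕜 H] [CompleteSpace H]
    [NormedSpace ℝ H] [IsScalarTower ℝ 𝕜 H]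
    [NormedAddCommGroup U] [InnerProductSpace 𝕜 U] [CompleteSpace U]
    (A : H →ₗ.[𝕜] H) (hdense : Dense (A.domain : Set H)) (hclosed : A.IsClosed)
    (hA : OpDissipative A) (hA' : OpDissipative A.adjoint)
    (B : U →L[𝕜] H) (d₀ d₁ : ℝ) (hd₀ : 0 < d₀)
    (hstable : IsGloballyExpStable A B d₀) :
    ∃ K β : ℝ, 0 < K ∧ 0 < β ∧
      ∀ d : ℝ → ℝ, ContinuousOn d (Ici 0) → (∀ t : ℝ, 0 ≤ t → d₀ ≤ d t ∧ d t ≤ d₁) →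
        ∀ v₀ : H, ∃ v : ℝ → H, IsMildSolution A B d v₀ v ∧
          (∀ w : ℝ → H, IsMildSolution A B d v₀ w → ∀ t : ℝ, 0 ≤ t → w t = v t) ∧
          ∀ t : ℝ, 0 ≤ t → ‖v t‖ ≤ K * Real.exp (-β * t) * ‖v₀‖ := by
  obtain ⟨K₀, β₀, hK₀, hβ₀, hst⟩ := hstable
  obtain ⟨τ, hτ, hτhalf⟩ : ∃ τ : ℝ, 0 < τ ∧ K₀ * Real.exp (-β₀ * τ) ≤ 1 / 2 := by
    have h1 : Tendsto (fun τ : ℝ => K₀ * Real.exp (-(β₀ * τ))) atTop (𝓝 (K₀ * 0)) :=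
      (Real.tendsto_exp_neg_atTop_nhds_zero.comp
        (tendsto_id.const_mul_atTop hβ₀)).const_mul K₀
    rw [mul_zero] at h1
    obtain ⟨τ, h2, h3⟩ := ((h1.eventually (Iic_mem_nhds (by norm_num : (0 : ℝ) < 1 / 2))).and
      (eventually_gt_atTop 0)).exists
    exact ⟨τ, h3, by simpa [neg_mul] using h2⟩
  have hQ : 0 ≤ (d₁ - d₀) ^ 2 / (2 * d₀ ^ 2) := by positivity
  set γ : ℝ := (1 / 2 + (d₁ - d₀) ^ 2 / (2 * d₀ ^ 2)) / (1 + (d₁ - d₀) ^ 2 / (2 * d₀ ^ 2)) with hγ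
  have hγ0 : 0 < γ := by positivity
  have hγ1 : γ < 1 := by rw [hγ, div_lt_one (by positivity)]; linarith
  -- Quantifying over all gains and initial states keeps `γ` and `τ` independent of `d`, and lets
  -- the step apply to time translates.
  have hstep : ∀ (q : ℝ → ℝ) (x : H) (z : ℝ → H), Continuous q →
      (∀ t, 0 ≤ t → d₀ ≤ q t ∧ q t ≤ d₁) →
      IsInhomMildSolution A x (fun s => -(q s • (B ∘L B.adjoint) (z s))) z →
      ‖z τ‖ ^ 2 ≤ γ * ‖x‖ ^ 2 := by
    intro q x z hq hqb hz
    obtain ⟨w, hw⟩ := exists_isInhomMildSolution_feedback hdense hclosed hA hA' (B ∘L B.adjoint)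
      (q := fun _ => d₀) continuous_const (C := d₀) (fun _ => (abs_of_pos hd₀).le) x
    refine norm_sq_le_mul_of_half hdense hclosed hA hA' hq hz hw hd₀ hqb hτ.le ?_
    exact (hst x w (hw.isMildSolution fun _ _ => rfl) τ hτ.le).trans
      (mul_le_mul_of_nonneg_right hτhalf (norm_nonneg _))
  refine ⟨γ⁻¹, -Real.log γ / (2 * τ), inv_pos.2 hγ0,
    div_pos (neg_pos.2 (Real.log_neg hγ0 hγ1)) (by positivity), fun d hd hdb v₀ => ?_⟩
  set q : ℝ → ℝ := fun s => d (max s 0) with hq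
  have hqc : Continuous q := hd.comp_continuous (by fun_prop) fun s => le_max_right s 0
  have hqb : ∀ s, d₀ ≤ q s ∧ q s ≤ d₁ := fun s => hdb _ (le_max_right s 0)
  have hq0 : ∀ s, 0 ≤ q s := fun s => hd₀.le.trans (hqb s).1
  obtain ⟨v, hv⟩ := exists_isInhomMildSolution_feedback hdense hclosed hA hA' (B ∘L B.adjoint)
    hqc (C := d₁) (fun s => by rw [abs_of_nonneg (hq0 s)]; exact (hqb s).2) v₀
  have hvc := hv.continuous
  have hcont : Continuous fun s => -(q s • (B ∘L B.adjoint) (v s)) := by fun_prop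
  refine ⟨v, hv.isMildSolution fun t ht => by simp [hq, max_eq_left ht], fun w hw t ht => ?_,
    fun t ht => ?_⟩
  · have := feedback_unique hdense hclosed hA hA' hqc hw.isInhomMildSolution hv
      (fun t _ => hq0 t) ht
    simpa [max_eq_left ht] using this
  · refine le_exp_of_geometric (φ := fun t => ‖v t‖) hγ0 hγ1 hτ (norm_nonneg _) ?_ ht
    -- Monotonicity of the norm covers the times between multiples of `τ`.
    have hmono : ∀ a t, 0 ≤ a → a ≤ t → ‖v t‖ ^ 2 ≤ ‖v a‖ ^ 2 := fun a t ha hat => by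
      have := norm_sq_le_of_feedback hdense hclosed hA hA' (by fun_prop) (hv.shift hcont ha)
        (fun s _ => hq0 (s + a)) (sub_nonneg.2 hat)
      simpa using this
    have hgeo : ∀ n : ℕ, ‖v (n * τ)‖ ^ 2 ≤ γ ^ n * ‖v₀‖ ^ 2 := by
      intro n
      induction n with
      | zero =>
        have h0 : v 0 = v₀ := (hv.isMildSolution fun _ _ => rfl).initial
        simp [h0]
      | succ n ih =>
        have := hstep _ _ _ (by fun_prop) (fun s _ => hqb (s + n * τ))
          (hv.shift hcont (a := n * τ) (by positivity))
        rw [show ((n + 1 : ℕ) : ℝ) * τ = τ + n * τ by push_cast; ring, pow_succ' γ, mul_assoc]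
        exact this.trans (mul_le_mul_of_nonneg_left ih hγ0.le)
    exact fun n t hnt => (hmono _ t (by positivity) hnt).trans (hgeo n)
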